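/- Let $A$ and $B$ be positive semidefinite complex $n\times n$ matrices, and let $C=(A^{1/2}BA^{1/2})^{1/2}$, where $X^{1/2}$ denotes the unique positive semidefinite square root of a positive semidefinite matrix $X$. Then $$\operatorname{tr}(e^{-A}e^{-B})\;\le\;\operatorname{tr}(e^{-A}+e^{-B})+\operatorname{tr}(e^{-2C}-2e^{-C}).$$ (All traces here are real numbers.) -/

import Mathlib

open scoped Matrix MatrixOrder ComplexOrder

/-! Put `f x = 1 - exp (-x)`. Expanding products turns the claim into tr f(A)f(B) ≤ tr f(C)². The
left side is the sum of the squared singular values of f(A)^{1/2} f(B)^{1/2}, and the eigenvalues of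
C are the singular values c₁ ≥ c₂ ≥ … of A^{1/2}B^{1/2}. By `sum_le_sum_of_prod_le_prod` it is
enough that, for every k, the product of the k largest singular values of f(A)^{1/2} f(B)^{1/2} is
at most f(c₁)⋯f(c_k).

For a truncation f = min(·, s) this holds term by term: Weyl monotonicity bounds the j-th singular
value both by c_j and by s (`norm_compound_sandwich_logSqrtMin_le`). The product of the k largest
singular values is the operator norm of the k-th compound, which is multiplicative in the matrix, so
Hadamard's three lines theorem carries the bound to weighted geometric means of functions f
(`convex_setOf_norm_compound_sandwich_le`). Finally t ↦ log f(eᵗ) is concave with slopes in [0, 1],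
so on a finite set it is a constant plus a convex combination of functions min(t, s). Thus f is
there a geometric mean of multiples of truncations (`exists_sum_logSqrtMin`). -/

namespace Matrix

open Set

/-! ### Compound matrices -/

section Compound

variable {R : Type*} [CommRing R] {I : Type*} [LinearOrder I]

/-- The `k`-th compound matrix: the matrix of all `k × k` minors. -/
noncomputable def compound (k : ℕ) (M : Matrix I I R) :
    Matrix (powersetCard I k) (powersetCard I k) R :=
  of fun s t => (M.submatrix (powersetCard.ofFinEmbEquiv.symm s)
    (powersetCard.ofFinEmbEquiv.symm t)).det

/-- Makes the Cauchy–Binet formula a consequence of functoriality of exterior powers. -/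
lemma compound_eq_toMatrix [Fintype I] (k : ℕ) (M : Matrix I I R) :
    compound k M = LinearMap.toMatrix ((Pi.basisFun R I).exteriorPower k)
      ((Pi.basisFun R I).exteriorPower k) (exteriorPower.map k (toLin' M)) := by
  ext s t
  rw [LinearMap.toMatrix_apply, exteriorPower.basis_repr_apply, exteriorPower.basis_apply,
    exteriorPower.ιMulti_family, exteriorPower.map_apply_ιMulti,
    exteriorPower.ιMultiDual_apply_ιMulti, compound, of_apply, ← det_transpose]
  congr 1
  ext i j
  simp

lemma compound_mul [Fintype I] (k : ℕ) (M N : Matrix I I R) :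
    compound k (M * N) = compound k M * compound k N := by
  simp only [compound_eq_toMatrix]
  rw [← LinearMap.toMatrix_mul, toLin'_mul, Module.End.mul_eq_comp, exteriorPower.map_comp]

lemma compound_diagonal (k : ℕ) (d : I → R) :
    compound k (diagonal d) =
      diagonal fun s => ∏ i, d (powersetCard.ofFinEmbEquiv.symm s i) := by
  ext s t
  rw [compound, of_apply]
  by_cases h : s = t
  · subst h
    rw [diagonal_apply_eq, ← det_diagonal]
    congr 1
    ext i j
    simp [diagonal_apply]
  · rw [diagonal_apply_ne _ h]
    -- An index in `s` but not in `t` gives a zero row of the minor.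
    obtain ⟨i, his, hit⟩ := (powersetCard.exists_mem_notMem_iff_ne s t).mp h
    obtain ⟨l, rfl⟩ := (powersetCard.mem_range_ofFinEmbEquiv_symm_iff_mem s i).mpr his
    refine det_eq_zero_of_row_eq_zero l fun j => ?_
    rw [submatrix_apply, diagonal_apply_ne]
    rintro e
    apply hit
    rw [e]
    exact (powersetCard.mem_range_ofFinEmbEquiv_symm_iff_mem t _).mp ⟨j, rfl⟩

lemma compound_one [Fintype I] (k : ℕ) : compound k (1 : Matrix I I R) = 1 := by
  rw [← diagonal_one, compound_diagonal]
  simp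

lemma compound_conjTranspose [StarRing R] (k : ℕ) (M : Matrix I I R) :
    compound k Mᴴ = (compound k M)ᴴ := by
  ext s t
  rw [conjTranspose_apply, compound, compound, of_apply, of_apply, ← det_conjTranspose,
    conjTranspose_submatrix]

lemma compound_mem_unitary [Fintype I] [StarRing R] (k : ℕ) {U : Matrix I I R}
    (hU : U ∈ unitaryGroup I R) :
    compound k U ∈ unitaryGroup (powersetCard I k) R := by
  rw [mem_unitaryGroup_iff, star_eq_conjTranspose, ← compound_conjTranspose, ← compound_mul,
    ← star_eq_conjTranspose, mem_unitaryGroup_iff.mp hU, compound_one]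

end Compound

end Matrix

/-- Shows that a decreasing nonnegative sequence has its largest `k`-fold product on the initial
segment. -/
lemma Fin.castLE_le_of_strictMono {k N : ℕ} (hk : k ≤ N) {e : Fin k → Fin N}
    (he : StrictMono e) (i : Fin k) : Fin.castLE hk i ≤ e i := by
  obtain ⟨i, hi⟩ := i
  induction i with
  | zero => exact Nat.zero_le _
  | succ m ih =>
    have h1 : m < (e ⟨m + 1, hi⟩).val :=
      lt_of_le_of_lt (ih (by omega)) (he (show (⟨m, by omega⟩ : Fin k) < ⟨m + 1, hi⟩ by simp))
    exact h1

/-! ### Eigenvalues in decreasing order -/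

namespace Matrix

/-- `H` is unitarily diagonalizable with eigenvalues `α`, listed in decreasing order. -/
def HasSortedEigenvalues {N : ℕ} (H : Matrix (Fin N) (Fin N) ℂ) (α : Fin N → ℝ) : Prop :=
  Antitone α ∧ ∃ U ∈ unitaryGroup (Fin N) ℂ,
    H = U * diagonal (fun i => (α i : ℂ)) * star U

namespace HasSortedEigenvalues

variable {N : ℕ} {H K : Matrix (Fin N) (Fin N) ℂ} {α β : Fin N → ℝ}

lemma trace_eq (h : HasSortedEigenvalues H α) : H.trace = ∑ i, (α i : ℂ) := by
  obtain ⟨-, U, hU, rfl⟩ := h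
  rw [trace_mul_comm, ← mul_assoc, mem_unitaryGroup_iff'.mp hU, one_mul, trace_diagonal]

lemma charpoly_eq (h : HasSortedEigenvalues H α) :
    H.charpoly = ∏ i, (Polynomial.X - Polynomial.C (α i : ℂ)) := by
  obtain ⟨-, U, hU, rfl⟩ := h
  rw [charpoly_mul_comm, ← mul_assoc, mem_unitaryGroup_iff'.mp hU, one_mul, charpoly_diagonal]

/-- The roots determine the multiset of eigenvalues, and two sorted lists that are permutations of
each other coincide. -/
lemma eq_of_charpoly_eq (h : HasSortedEigenvalues H α) (h' : HasSortedEigenvalues K β)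
    (e : H.charpoly = K.charpoly) : α = β := by
  have hr : ∀ γ : Fin N → ℝ, (∏ i, (Polynomial.X - Polynomial.C (γ i : ℂ))).roots
      = Finset.univ.val.map fun i => (γ i : ℂ) := fun γ => by
    rw [Polynomial.roots_prod _ _ (Polynomial.monic_prod_X_sub_C _ _).ne_zero]
    simp
  have h1 := hr α
  rw [← h.charpoly_eq, e, h'.charpoly_eq, hr β] at h1
  have h2 := congrArg (Multiset.map Complex.re) h1
  simp only [Multiset.map_map, Function.comp_def, Complex.ofReal_re] at h2
  have h3 : (List.ofFn α).Perm (List.ofFn β) := by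
    rw [← Multiset.coe_eq_coe, ← Fin.univ_val_map, ← Fin.univ_val_map, h2]
  exact List.ofFn_injective
    (h3.eq_of_pairwise' h.1.sortedGE_ofFn.pairwise h'.1.sortedGE_ofFn.pairwise)

lemma nonneg (h : HasSortedEigenvalues H α) (hH : H.PosSemidef) (i : Fin N) : 0 ≤ α i := by
  obtain ⟨-, U, hU, rfl⟩ := h
  have h1 := hH.conjTranspose_mul_mul_same U
  rw [← star_eq_conjTranspose, mul_assoc, mul_assoc, mem_unitaryGroup_iff'.mp hU, mul_one,
    ← mul_assoc, mem_unitaryGroup_iff'.mp hU, one_mul, posSemidef_diagonal_iff] at h1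
  exact_mod_cast h1 i

end HasSortedEigenvalues

lemma IsHermitian.exists_hasSortedEigenvalues {N : ℕ} {H : Matrix (Fin N) (Fin N) ℂ}
    (hH : H.IsHermitian) : ∃ α, HasSortedEigenvalues H α := by
  set σ : Equiv.Perm (Fin N) := Tuple.sort (fun i => - hH.eigenvalues i)
  have hmono : Monotone ((fun i => - hH.eigenvalues i) ∘ σ) := Tuple.monotone_sort _
  set U : Matrix (Fin N) (Fin N) ℂ := hH.eigenvectorUnitary.1
  have hU : U ∈ unitaryGroup (Fin N) ℂ := hH.eigenvectorUnitary.2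
  refine ⟨hH.eigenvalues ∘ σ, fun i j hij => by simpa using hmono hij,
    U.submatrix id σ, ?_, ?_⟩
  · rw [mem_unitaryGroup_iff', star_eq_conjTranspose, conjTranspose_submatrix,
      ← submatrix_mul _ _ _ _ _ Function.bijective_id, ← star_eq_conjTranspose,
      mem_unitaryGroup_iff'.mp hU, submatrix_one_equiv]
  · have hD : diagonal (fun i => (((hH.eigenvalues ∘ σ) i : ℝ) : ℂ)) =
        (diagonal fun i => (hH.eigenvalues i : ℂ)).submatrix σ σ := by
      rw [submatrix_diagonal_equiv]
      rfl
    rw [hD, submatrix_mul_equiv, star_eq_conjTranspose, conjTranspose_submatrix,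
      submatrix_mul_equiv, submatrix_id_id]
    have := hH.spectral_theorem
    rw [Unitary.conjStarAlgAut_apply] at this
    exact this

/-! ### Rayleigh quotients and Weyl monotonicity -/

section Weyl

variable {N : ℕ}

lemma dotProduct_conj_diagonal_mulVec (U : Matrix (Fin N) (Fin N) ℂ) (α : Fin N → ℝ)
    (x : Fin N → ℂ) :
    star x ⬝ᵥ (U * diagonal (fun i => (α i : ℂ)) * star U) *ᵥ x =
      ((∑ i, α i * ‖(star U *ᵥ x) i‖ ^ 2 : ℝ) : ℂ) := by
  rw [← mulVec_mulVec, ← mulVec_mulVec, dotProduct_mulVec]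
  have : star x ᵥ* U = star (star U *ᵥ x) := by
    rw [star_mulVec, star_eq_conjTranspose, conjTranspose_conjTranspose]
  rw [this, dotProduct, Complex.ofReal_sum]
  refine Finset.sum_congr rfl fun i _ => ?_
  rw [mulVec_diagonal, Pi.star_apply, mul_left_comm, RCLike.star_def, Complex.conj_mul']
  push_cast
  ring

lemma sum_norm_sq_star_mulVec {U : Matrix (Fin N) (Fin N) ℂ}
    (hU : U ∈ unitaryGroup (Fin N) ℂ) (x : Fin N → ℂ) :
    ∑ i, ‖(star U *ᵥ x) i‖ ^ 2 = ∑ i, ‖x i‖ ^ 2 := by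
  have h1 := dotProduct_conj_diagonal_mulVec U (fun _ => 1) x
  have h2 := dotProduct_conj_diagonal_mulVec (1 : Matrix (Fin N) (Fin N) ℂ) (fun _ => 1) x
  simp only [Complex.ofReal_one, diagonal_one, mul_one, mem_unitaryGroup_iff.mp hU, one_mul,
    star_one, one_mulVec] at h1 h2
  exact_mod_cast h1.symm.trans h2

/-- **Weyl's monotonicity principle**. -/
lemma HasSortedEigenvalues.mono {H K : Matrix (Fin N) (Fin N) ℂ} {α β : Fin N → ℝ}
    (hH : HasSortedEigenvalues H α) (hK : HasSortedEigenvalues K β) (hHK : H ≤ K) (j : Fin N) :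
    α j ≤ β j := by
  obtain ⟨hα, U, hU, rfl⟩ := hH
  obtain ⟨hβ, V, hV, rfl⟩ := hK
  -- A kernel vector is orthogonal to the eigenvectors of `H` after `j` and to those of `K` before
  -- `j`. These are N - 1 conditions, so a nonzero one exists; its two quadratic forms separate `α
  -- j` from `β j`.
  let F : (Fin N → ℂ) →ₗ[ℂ] ({i // i ≠ j} → ℂ) := LinearMap.pi fun i =>
    LinearMap.proj i.1 ∘ₗ (if j < i.1 then toLin' (star U) else toLin' (star V))
  have hF : LinearMap.ker F ≠ ⊥ := by
    refine LinearMap.ker_ne_bot_of_finrank_lt ?_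
    rw [Module.finrank_fintype_fun_eq_card, Module.finrank_fintype_fun_eq_card]
    exact Fintype.card_subtype_lt (x := j) (by simp)
  obtain ⟨x, hx, hx0⟩ := (Submodule.ne_bot_iff _).mp hF
  have hx' : ∀ i, i ≠ j → (if j < i then toLin' (star U) else toLin' (star V)) x i = 0 :=
    fun i hi => congrFun (LinearMap.mem_ker.mp hx) ⟨i, hi⟩
  have hUx : ∀ i, j < i → (star U *ᵥ x) i = 0 := fun i hi => by
    simpa [hi] using hx' i hi.ne'
  have hVx : ∀ i, i < j → (star V *ᵥ x) i = 0 := fun i hi => by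
    simpa [hi.not_gt] using hx' i hi.ne
  have hpos : 0 < ∑ i, ‖x i‖ ^ 2 := by
    obtain ⟨i, hi⟩ := Function.ne_iff.mp hx0
    exact Finset.sum_pos' (fun _ _ => by positivity)
      ⟨i, Finset.mem_univ _, pow_pos (norm_pos_iff.mpr hi) 2⟩
  have h1 := (le_iff.mp hHK).dotProduct_mulVec_nonneg x
  rw [sub_mulVec, dotProduct_sub, dotProduct_conj_diagonal_mulVec,
    dotProduct_conj_diagonal_mulVec, sub_nonneg, Complex.real_le_real] at h1
  have h2 : α j * ∑ i, ‖x i‖ ^ 2 ≤ ∑ i, α i * ‖(star U *ᵥ x) i‖ ^ 2 := by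
    rw [← sum_norm_sq_star_mulVec hU, Finset.mul_sum]
    refine Finset.sum_le_sum fun i _ => ?_
    rcases lt_or_ge j i with h | h
    · simp [hUx i h]
    · exact mul_le_mul_of_nonneg_right (hα h) (by positivity)
  have h3 : ∑ i, β i * ‖(star V *ᵥ x) i‖ ^ 2 ≤ β j * ∑ i, ‖x i‖ ^ 2 := by
    rw [← sum_norm_sq_star_mulVec hV, Finset.mul_sum]
    refine Finset.sum_le_sum fun i _ => ?_
    rcases lt_or_ge i j with h | h
    · simp [hVx i h]
    · exact mul_le_mul_of_nonneg_right (hβ h) (by positivity)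
  exact le_of_mul_le_mul_right (h2.trans (h1.trans h3)) hpos

end Weyl

/-! ### Norms of compounds as products of the largest eigenvalues -/

section CompoundNorm

open scoped Matrix.Norms.L2Operator
open Set

variable {N : ℕ} {H : Matrix (Fin N) (Fin N) ℂ} {α : Fin N → ℝ}

lemma HasSortedEigenvalues.norm_compound (h : HasSortedEigenvalues H α) (h0 : ∀ i, 0 ≤ α i)
    {k : ℕ} (hk : k ≤ N) :
    ‖compound k H‖ = ∏ i : Fin k, α (Fin.castLE hk i) := by
  obtain ⟨hα, U, hU, rfl⟩ := h
  have hC := compound_mem_unitary k hU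
  rw [compound_mul, compound_mul, star_eq_conjTranspose, compound_conjTranspose,
    ← star_eq_conjTranspose, CStarRing.norm_mul_mem_unitary _ (Unitary.star_mem hC),
    CStarRing.norm_mem_unitary_mul _ hC, compound_diagonal, l2_opNorm_diagonal]
  refine le_antisymm ((pi_norm_le_iff_of_nonneg (Finset.prod_nonneg fun _ _ => h0 _)).mpr
    fun s => ?_) ?_
  · rw [norm_prod]
    refine Finset.prod_le_prod (fun _ _ => norm_nonneg _) fun i _ => ?_
    rw [Complex.norm_real, Real.norm_of_nonneg (h0 _)]
    exact hα (Fin.castLE_le_of_strictMono hk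
      (powersetCard.ofFinEmbEquiv.symm s).strictMono i)
  · set s : powersetCard (Fin N) k := powersetCard.ofFinEmbEquiv (Fin.castLEOrderEmb hk)
    refine le_trans (le_of_eq ?_) (norm_le_pi_norm _ s)
    rw [norm_prod]
    refine Finset.prod_congr rfl fun i _ => ?_
    rw [Complex.norm_real, Real.norm_of_nonneg (h0 _), Equiv.symm_apply_apply]
    rfl

/-- By the C*-identity, the norm of the compound is the product of the `k` largest singular values
of `T`. -/
lemma HasSortedEigenvalues.norm_compound_sq {T : Matrix (Fin N) (Fin N) ℂ}
    (h : HasSortedEigenvalues (T * Tᴴ) α) {k : ℕ} (hk : k ≤ N) :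
    ‖compound k T‖ ^ 2 = ∏ i : Fin k, α (Fin.castLE hk i) := by
  rw [← h.norm_compound (h.nonneg (posSemidef_self_mul_conjTranspose T)) hk, compound_mul,
    compound_conjTranspose, ← l2_opNorm_conjTranspose, sq, ← l2_opNorm_conjTranspose_mul_self,
    conjTranspose_conjTranspose]

end CompoundNorm

/-! ### Interpolation by the three lines theorem -/

section ThreeLines

open scoped Matrix.Norms.L2Operator

/-- The analytic interpolation `x ^ z * y ^ (1 - z)` of nonnegative numbers, vanishing identically
as soon as one of them is zero. -/
noncomputable def interp (x y : ℝ) (z : ℂ) : ℂ :=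
  if x = 0 ∨ y = 0 then 0 else Complex.exp (z * Real.log x + (1 - z) * Real.log y)

lemma differentiable_interp (x y : ℝ) : Differentiable ℂ (interp x y) := by
  unfold interp
  split_ifs <;> fun_prop

lemma norm_interp_le (x y : ℝ) {z : ℂ}
    (hz : z ∈ Complex.HadamardThreeLines.verticalClosedStrip 0 1) :
    ‖interp x y z‖ ≤ Real.exp (|Real.log x| + |Real.log y|) := by
  obtain ⟨h0, h1⟩ := hz
  unfold interp
  split_ifs
  · simpa using (Real.exp_pos _).le
  · rw [Complex.norm_exp]
    refine Real.exp_le_exp.mpr ?_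
    simp only [Complex.add_re, Complex.mul_re, Complex.ofReal_re, Complex.ofReal_im, mul_zero,
      sub_zero, Complex.sub_re, Complex.one_re]
    exact add_le_add
      ((mul_le_mul_of_nonneg_left (le_abs_self _) h0).trans
        (mul_le_of_le_one_left (abs_nonneg _) h1))
      ((mul_le_mul_of_nonneg_left (le_abs_self _) (by linarith)).trans
        (mul_le_of_le_one_left (abs_nonneg _) (by linarith)))

lemma exists_interp_eq_mul_right {x y : ℝ} (hy : 0 ≤ y) {z : ℂ} (hz : z.re = 0) :
    ∃ u : ℂ, ‖u‖ ≤ 1 ∧ interp x y z = u * y := by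
  unfold interp
  split_ifs with h
  · exact ⟨0, by simp, by simp⟩
  · push Not at h
    refine ⟨Complex.exp (z * (Real.log x - Real.log y : ℝ)), ?_, ?_⟩
    · rw [Complex.norm_exp]
      simp [hz]
    · have hy' : (y : ℂ) = Complex.exp (Real.log y) := by
        rw [← Complex.ofReal_exp, Real.exp_log (hy.lt_of_ne' h.2)]
      conv_rhs => rw [hy', ← Complex.exp_add]
      congr 1
      push_cast
      ring

lemma interp_one_sub (x y : ℝ) (z : ℂ) : interp x y (1 - z) = interp y x z := by
  unfold interp
  simp only [or_comm, sub_sub_cancel, add_comm]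

lemma interp_ofReal {x y : ℝ} (hx : 0 ≤ x) (hy : 0 ≤ y) {t : ℝ} (h0 : 0 < t) (h1 : t < 1) :
    interp x y t = (x ^ t * y ^ (1 - t) : ℝ) := by
  unfold interp
  split_ifs with h
  · rcases h with rfl | rfl
    · rw [Real.zero_rpow h0.ne']
      simp
    · rw [Real.zero_rpow (by linarith)]
      simp
  · push Not at h
    rw [Real.rpow_def_of_pos (hx.lt_of_ne' h.1), Real.rpow_def_of_pos (hy.lt_of_ne' h.2),
      ← Real.exp_add]
    push_cast
    congr 1
    ring

variable {κ : Type*} [Fintype κ] [DecidableEq κ]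

/-- On Re z = 0 the interpolated diagonals differ from `p'` and `q'` only by diagonal contractions.
-/
lemma norm_diagonal_interp_mul_le_right (L : Matrix κ κ ℂ) {p p' q q' : κ → ℝ}
    (hp' : ∀ i, 0 ≤ p' i) (hq' : ∀ i, 0 ≤ q' i) {z : ℂ} (hz : z.re = 0) :
    ‖diagonal (fun i => interp (p i) (p' i) z) * L * diagonal (fun i => interp (q i) (q' i) z)‖ ≤
      ‖diagonal (fun i => (p' i : ℂ)) * L * diagonal (fun i => (q' i : ℂ))‖ := by
  choose u hu hu' using fun i => exists_interp_eq_mul_right (x := p i) (hp' i) hz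
  choose v hv hv' using fun i => exists_interp_eq_mul_right (x := q i) (hq' i) hz
  simp only [hu', hv']
  have e : diagonal (fun i => u i * (p' i : ℂ)) * L * diagonal (fun i => v i * (q' i : ℂ)) =
      diagonal u * (diagonal (fun i => (p' i : ℂ)) * L * diagonal (fun i => (q' i : ℂ))) *
        diagonal v := by
    rw [← diagonal_mul_diagonal]
    simp only [mul_comm (v _)]
    rw [← diagonal_mul_diagonal]
    simp only [mul_assoc]
  rw [e]
  have h1 : ‖diagonal u‖ ≤ 1 := by
    rw [l2_opNorm_diagonal]
    exact (pi_norm_le_iff_of_nonneg zero_le_one).mpr hu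
  have h2 : ‖diagonal v‖ ≤ 1 := by
    rw [l2_opNorm_diagonal]
    exact (pi_norm_le_iff_of_nonneg zero_le_one).mpr hv
  calc _ ≤ ‖diagonal u‖ * ‖_‖ * ‖diagonal v‖ :=
        (norm_mul_le _ _).trans (mul_le_mul_of_nonneg_right (norm_mul_le _ _) (norm_nonneg _))
    _ ≤ 1 * ‖_‖ * 1 := by
        gcongr
        positivity
    _ = _ := by rw [one_mul, mul_one]

/-- Log-convexity of the operator norm along geometric interpolation of diagonal factors. -/
lemma norm_diagonal_rpow_mul_le (L : Matrix κ κ ℂ) {p p' q q' : κ → ℝ}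
    (hp : ∀ i, 0 ≤ p i) (hp' : ∀ i, 0 ≤ p' i) (hq : ∀ i, 0 ≤ q i) (hq' : ∀ i, 0 ≤ q' i)
    {r r' : ℝ} (h : ‖diagonal (fun i => (p i : ℂ)) * L * diagonal (fun i => (q i : ℂ))‖ ≤ r)
    (h' : ‖diagonal (fun i => (p' i : ℂ)) * L * diagonal (fun i => (q' i : ℂ))‖ ≤ r')
    {t : ℝ} (h0 : 0 < t) (h1 : t < 1) :
    ‖diagonal (fun i => ((p i ^ t * p' i ^ (1 - t) : ℝ) : ℂ)) * L *
      diagonal (fun i => ((q i ^ t * q' i ^ (1 - t) : ℝ) : ℂ))‖ ≤ r ^ t * r' ^ (1 - t) := by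
  set F : ℂ → Matrix κ κ ℂ := fun z => diagonal (fun i => interp (p i) (p' i) z) * L *
    diagonal (fun i => interp (q i) (q' i) z) with hF
  have hdiag : ∀ x y : κ → ℝ,
      Differentiable ℂ (fun z => (diagonal (fun i => interp (x i) (y i) z) : Matrix κ κ ℂ)) :=
    fun x y => ((diagonalLinearMap κ ℂ ℂ).toContinuousLinearMap.differentiable).comp
      (differentiable_pi.mpr fun i => differentiable_interp (x i) (y i))
  have hd : Differentiable ℂ F :=
    ((hdiag p p').mul (differentiable_const L)).mul (hdiag q q')
  have hbd : ∀ x y : κ → ℝ, ∃ R, ∀ z ∈ Complex.HadamardThreeLines.verticalClosedStrip 0 1,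
      ‖(diagonal (fun i => interp (x i) (y i) z) : Matrix κ κ ℂ)‖ ≤ R := fun x y => by
    refine ⟨∑ i, Real.exp (|Real.log (x i)| + |Real.log (y i)|), fun z hz => ?_⟩
    rw [l2_opNorm_diagonal]
    refine (pi_norm_le_iff_of_nonneg (Finset.sum_nonneg fun _ _ => (Real.exp_pos _).le)).mpr
      fun i => (norm_interp_le _ _ hz).trans ?_
    exact Finset.single_le_sum (f := fun i => Real.exp (|Real.log (x i)| + |Real.log (y i)|))
      (fun _ _ => (Real.exp_pos _).le) (Finset.mem_univ i)
  obtain ⟨R, hR⟩ := hbd p p'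
  obtain ⟨R', hR'⟩ := hbd q q'
  have hB : BddAbove ((norm ∘ F) '' Complex.HadamardThreeLines.verticalClosedStrip 0 1) := by
    refine ⟨R * ‖L‖ * R', ?_⟩
    rintro _ ⟨z, hz, rfl⟩
    have hR0 : 0 ≤ R := (norm_nonneg _).trans (hR z hz)
    calc _ ≤ ‖_‖ * ‖L‖ * ‖_‖ :=
          (norm_mul_le _ _).trans (mul_le_mul_of_nonneg_right (norm_mul_le _ _) (norm_nonneg _))
      _ ≤ R * ‖L‖ * R' := by
          gcongr
          · exact hR z hz
          · exact hR' z hz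
  have key := Complex.HadamardThreeLines.norm_le_interp_of_mem_verticalClosedStrip' (f := F)
    (z := (t : ℂ)) (a := r') (b := r) zero_lt_one ⟨by simpa using h0.le, by simpa using h1.le⟩
    hd.diffContOnCl hB
    (fun z hz => (norm_diagonal_interp_mul_le_right L hp' hq' hz).trans h')
    -- The line Re z = 1 reduces to Re z = 0 through z ↦ 1 - z, which swaps the endpoints.
    (fun z hz => by
      have hz' : z.re = 1 := hz
      have := norm_diagonal_interp_mul_le_right (p := p') (q := q') L hp hq (z := 1 - z)
        (by simp [hz'])
      simp only [interp_one_sub] at this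
      exact this.trans h)
  simp only [hF, Complex.ofReal_re, sub_zero, div_one] at key
  rw [mul_comm]
  refine le_of_eq_of_le ?_ key
  simp only [interp_ofReal (hp _) (hp' _) h0 h1, interp_ofReal (hq _) (hq' _) h0 h1]

end ThreeLines

end Matrix

/-! ### Functions in exponential form -/

/-- The function equal to `exp ∘ φ` off zero, and vanishing at zero. -/
noncomputable def expOffZero (φ : ℝ → ℝ) (x : ℝ) : ℝ := if x = 0 then 0 else Real.exp (φ x)

lemma expOffZero_nonneg (φ : ℝ → ℝ) (x : ℝ) : 0 ≤ expOffZero φ x := by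
  unfold expOffZero
  split_ifs
  exacts [le_rfl, (Real.exp_pos _).le]

/-- Geometric means of functions become convex combinations of exponents, so that convexity
arguments apply. -/
lemma expOffZero_combo (φ ψ : ℝ → ℝ) {t : ℝ} (h0 : 0 < t) (x : ℝ) :
    expOffZero (t • φ + (1 - t) • ψ) x = expOffZero φ x ^ t * expOffZero ψ x ^ (1 - t) := by
  unfold expOffZero
  split_ifs
  · rw [Real.zero_rpow h0.ne', zero_mul]
  · rw [← Real.exp_mul, ← Real.exp_mul, ← Real.exp_add]
    simp [mul_comm]

/-- The logarithm of the square root of `exp (2 * d) * min x s`. -/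
noncomputable def logSqrtMin (s d : ℝ) (x : ℝ) : ℝ := Real.log (min x s) / 2 + d

lemma expOffZero_logSqrtMin {s : ℝ} (hs : 0 < s) (d : ℝ) {x : ℝ} (hx : 0 ≤ x) :
    expOffZero (logSqrtMin s d) x = Real.exp d * √(min x s) := by
  unfold expOffZero logSqrtMin
  split_ifs with h
  · simp [h, hs.le]
  · have : 0 < min x s := lt_min (hx.lt_of_ne' h) hs
    rw [Real.exp_add, Real.sqrt_eq_rpow, Real.rpow_def_of_pos this, mul_comm, div_eq_mul_one_div]

namespace Matrix

/-! ### Monotonicity and bounds for singular values -/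

section Truncation

variable {N : ℕ}

/-- The complex diagonal matrix with prescribed real entries. -/
noncomputable abbrev realDiagonal {κ : Type*} [DecidableEq κ] (x : κ → ℝ) : Matrix κ κ ℂ :=
  diagonal fun i => (x i : ℂ)

lemma realDiagonal_conjTranspose {κ : Type*} [DecidableEq κ] (x : κ → ℝ) :
    (realDiagonal x)ᴴ = realDiagonal x := by
  rw [diagonal_conjTranspose]
  congr 1
  ext i
  simp

lemma realDiagonal_le {κ : Type*} [DecidableEq κ] [Fintype κ] {x y : κ → ℝ} (h : ∀ i, x i ≤ y i) :
    realDiagonal x ≤ realDiagonal y := by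
  rw [le_iff, diagonal_sub]
  refine PosSemidef.diagonal fun i => ?_
  simpa using h i

lemma realDiagonal_mul {κ : Type*} [DecidableEq κ] [Fintype κ] (x y : κ → ℝ) :
    realDiagonal x * realDiagonal y = realDiagonal fun i => x i * y i := by
  rw [diagonal_mul_diagonal]
  simp

lemma realDiagonal_smul {κ : Type*} [DecidableEq κ] (r : ℝ) (x : κ → ℝ) :
    (realDiagonal fun i => r * x i) = (r : ℂ) • realDiagonal x := by
  rw [realDiagonal, ← diagonal_smul]
  congr 1
  ext i
  simp

lemma realDiagonal_const {κ : Type*} [DecidableEq κ] (r : ℝ) :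
    (realDiagonal fun _ : κ => r) = (r : ℂ) • 1 :=
  (smul_one_eq_diagonal _).symm

lemma conj_le_conj {κ : Type*} [Fintype κ] {X Y : Matrix κ κ ℂ} (h : X ≤ Y)
    (Z : Matrix κ κ ℂ) : Z * X * Zᴴ ≤ Z * Y * Zᴴ := by
  rw [le_iff, ← sub_mul, ← mul_sub]
  exact (le_iff.mp h).mul_mul_conjTranspose_same Z

lemma mul_realDiagonal_sqrt_mul_conjTranspose {κ : Type*} [DecidableEq κ] [Fintype κ]
    (Z : Matrix κ κ ℂ) {x : κ → ℝ} (hx : ∀ i, 0 ≤ x i) :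
    (Z * realDiagonal fun i => √(x i)) * (Z * realDiagonal fun i => √(x i))ᴴ =
      Z * realDiagonal x * Zᴴ := by
  rw [conjTranspose_mul, realDiagonal_conjTranspose, mul_assoc, ← mul_assoc (realDiagonal _),
    realDiagonal_mul, mul_assoc]
  simp only [Real.mul_self_sqrt (hx _)]

lemma HasSortedEigenvalues.eq_of_mul_conjTranspose {X : Matrix (Fin N) (Fin N) ℂ}
    {α β : Fin N → ℝ} (h : HasSortedEigenvalues (X * Xᴴ) α)
    (h' : HasSortedEigenvalues (Xᴴ * X) β) : α = β :=
  h.eq_of_charpoly_eq h' (charpoly_mul_comm _ _)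

lemma HasSortedEigenvalues.smul {H : Matrix (Fin N) (Fin N) ℂ} {α : Fin N → ℝ}
    (h : HasSortedEigenvalues H α) {r : ℝ} (hr : 0 ≤ r) :
    HasSortedEigenvalues ((r : ℂ) • H) fun i => r * α i := by
  obtain ⟨hα, U, hU, rfl⟩ := h
  refine ⟨fun i j hij => mul_le_mul_of_nonneg_left (hα hij) hr, U, hU, ?_⟩
  rw [← smul_mul_assoc, ← mul_smul_comm, ← diagonal_smul]
  congr 3
  ext i
  simp

lemma hasSortedEigenvalues_realDiagonal_const (r : ℝ) :
    HasSortedEigenvalues (realDiagonal fun _ : Fin N => r) fun _ => r :=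
  ⟨fun _ _ _ => le_rfl, 1, one_mem _, by simp⟩

variable {M : Matrix (Fin N) (Fin N) ℂ} {a a' b b' : Fin N → ℝ} {α α' : Fin N → ℝ}

lemma HasSortedEigenvalues.mono_right (ha : ∀ i, 0 ≤ b' i) (hb : ∀ i, b' i ≤ b i)
    {Z : Matrix (Fin N) (Fin N) ℂ}
    (h' : HasSortedEigenvalues ((Z * realDiagonal fun i => √(b' i)) *
      (Z * realDiagonal fun i => √(b' i))ᴴ) α')
    (h : HasSortedEigenvalues ((Z * realDiagonal fun i => √(b i)) *
      (Z * realDiagonal fun i => √(b i))ᴴ) α) (j : Fin N) : α' j ≤ α j := by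
  rw [mul_realDiagonal_sqrt_mul_conjTranspose Z ha] at h'
  rw [mul_realDiagonal_sqrt_mul_conjTranspose Z fun i => (ha i).trans (hb i)] at h
  exact h'.mono h (conj_le_conj (realDiagonal_le hb) Z) j

/-- The singular values of `a^(1/2) M b^(1/2)` increase with the diagonal matrices `a`, `b`. -/
lemma HasSortedEigenvalues.mono_sqrt_mul_sqrt (ha : ∀ i, 0 ≤ a' i) (haa : ∀ i, a' i ≤ a i)
    (hb : ∀ i, 0 ≤ b' i) (hbb : ∀ i, b' i ≤ b i)
    (h' : HasSortedEigenvalues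
      (((realDiagonal fun i => √(a' i)) * M * realDiagonal fun i => √(b' i)) *
      ((realDiagonal fun i => √(a' i)) * M * realDiagonal fun i => √(b' i))ᴴ) α')
    (h : HasSortedEigenvalues (((realDiagonal fun i => √(a i)) * M * realDiagonal fun i => √(b i)) *
      ((realDiagonal fun i => √(a i)) * M * realDiagonal fun i => √(b i))ᴴ) α) (j : Fin N) :
    α' j ≤ α j := by
  have hX : ∀ p : Fin N → ℝ, ((realDiagonal fun i => √(p i)) * M * realDiagonal fun i => √(b i))ᴴ =
      ((realDiagonal fun i => √(b i)) * Mᴴ) * realDiagonal fun i => √(p i) := fun p => by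
    simp only [conjTranspose_mul, realDiagonal_conjTranspose, mul_assoc]
  -- `X` changes one factor at a time: `X * Xᴴ` compares `b'` with `b`, and `Xᴴ * X`, with the same
  -- eigenvalues, compares `a'` with `a`.
  set X := (realDiagonal fun i => √(a' i)) * M * realDiagonal fun i => √(b i) with hXdef
  obtain ⟨β, hβ⟩ := (isHermitian_mul_conjTranspose_self X).exists_hasSortedEigenvalues
  obtain ⟨γ, hγ⟩ := (isHermitian_conjTranspose_mul_self X).exists_hasSortedEigenvalues
  set T := (realDiagonal fun i => √(a i)) * M * realDiagonal fun i => √(b i) with hTdef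
  obtain ⟨δ, hδ⟩ := (isHermitian_conjTranspose_mul_self T).exists_hasSortedEigenvalues
  refine (h'.mono_right hb hbb hβ j).trans ?_
  rw [hβ.eq_of_mul_conjTranspose hγ, h.eq_of_mul_conjTranspose hδ]
  rw [← conjTranspose_conjTranspose X, conjTranspose_conjTranspose Xᴴ, hX] at hγ
  rw [← conjTranspose_conjTranspose T, conjTranspose_conjTranspose Tᴴ, hX] at hδ
  exact hγ.mono_right ha haa hδ j

/-- Compare with the constant diagonals `s`, for which unitarity of `M` gives `T * Tᴴ = s ^ 2`. -/
lemma HasSortedEigenvalues.sqrt_mul_sqrt_le (hM : M ∈ unitaryGroup (Fin N) ℂ) {s : ℝ}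
    (ha : ∀ i, 0 ≤ a i) (has : ∀ i, a i ≤ s) (hb : ∀ i, 0 ≤ b i) (hbs : ∀ i, b i ≤ s)
    (h : HasSortedEigenvalues (((realDiagonal fun i => √(a i)) * M * realDiagonal fun i => √(b i)) *
      ((realDiagonal fun i => √(a i)) * M * realDiagonal fun i => √(b i))ᴴ) α) (j : Fin N) :
    α j ≤ s ^ 2 := by
  have hs : 0 ≤ s := (ha j).trans (has j)
  set T := (realDiagonal fun _ : Fin N => √s) * M * realDiagonal fun _ => √s
  have hT : T * Tᴴ = realDiagonal fun _ => s ^ 2 := by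
    rw [mul_realDiagonal_sqrt_mul_conjTranspose _ fun _ => hs, conjTranspose_mul,
      realDiagonal_conjTranspose]
    simp only [realDiagonal_const, smul_mul_assoc, mul_smul_comm, one_mul, mul_one, smul_smul]
    rw [← star_eq_conjTranspose, mem_unitaryGroup_iff.mp hM]
    congr 1
    norm_cast
    rw [mul_left_comm, Real.mul_self_sqrt hs, sq]
  have h' : HasSortedEigenvalues (T * Tᴴ) fun _ => s ^ 2 := by
    rw [hT]
    exact hasSortedEigenvalues_realDiagonal_const _
  exact h.mono_sqrt_mul_sqrt ha has hb hbs h' j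

end Truncation

/-! ### Log-majorization for truncations and its convexity -/

section Interpolation

open scoped Matrix.Norms.L2Operator

variable {N : ℕ}

/-- The matrix `φ(a) M φ(b)`, where `φ` is applied to the diagonal matrices `a` and `b` through
`expOffZero φ`. -/
noncomputable def sandwich (M : Matrix (Fin N) (Fin N) ℂ) (a b : Fin N → ℝ) (φ : ℝ → ℝ) :
    Matrix (Fin N) (Fin N) ℂ :=
  (realDiagonal fun i => expOffZero φ (a i)) * M * realDiagonal fun i => expOffZero φ (b i)

lemma compound_sandwich (k : ℕ) (M : Matrix (Fin N) (Fin N) ℂ) (a b : Fin N → ℝ) (φ : ℝ → ℝ) :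
    compound k (sandwich M a b φ) =
      (realDiagonal fun s => ∏ i, expOffZero φ (a (Set.powersetCard.ofFinEmbEquiv.symm s i))) *
        compound k M *
      realDiagonal fun s => ∏ i, expOffZero φ (b (Set.powersetCard.ofFinEmbEquiv.symm s i)) := by
  simp only [sandwich, realDiagonal, compound_mul, compound_diagonal, Complex.ofReal_prod]

lemma prod_expOffZero_combo {k : ℕ} (φ ψ : ℝ → ℝ) {t : ℝ} (h0 : 0 < t)
    (x : Fin k → ℝ) :
    ∏ i, expOffZero (t • φ + (1 - t) • ψ) (x i) =
      (∏ i, expOffZero φ (x i)) ^ t * (∏ i, expOffZero ψ (x i)) ^ (1 - t) := by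
  simp only [expOffZero_combo φ ψ h0, Finset.prod_mul_distrib]
  rw [Real.finsetProd_rpow _ _ fun _ _ => expOffZero_nonneg _ _,
    Real.finsetProd_rpow _ _ fun _ _ => expOffZero_nonneg _ _]

/-- The three lines bound applies to the compound, whose diagonal factors are again geometric means;
the right side is log-affine in `φ`. -/
lemma convex_setOf_norm_compound_sandwich_le (M : Matrix (Fin N) (Fin N) ℂ) (a b : Fin N → ℝ)
    {k : ℕ} (c : Fin k → ℝ) :
    Convex ℝ {φ | ‖compound k (sandwich M a b φ)‖ ≤ (∏ i, expOffZero φ (c i)) ^ 2} := by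
  rw [convex_iff_forall_pos]
  intro φ hφ ψ hψ t u ht hu htu
  obtain rfl : u = 1 - t := by linarith
  have ht1 : t < 1 := by linarith
  rw [Set.mem_ofPred_eq, compound_sandwich] at hφ hψ ⊢
  have h0 : ∀ (χ : ℝ → ℝ) (x : Fin k → ℝ), 0 ≤ ∏ i, expOffZero χ (x i) :=
    fun χ x => Finset.prod_nonneg fun _ _ => expOffZero_nonneg _ _
  have key := norm_diagonal_rpow_mul_le (compound k M) (fun _ => h0 _ _) (fun _ => h0 _ _)
    (fun _ => h0 _ _) (fun _ => h0 _ _) hφ hψ ht ht1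
  simp only [prod_expOffZero_combo φ ψ ht]
  refine key.trans (le_of_eq ?_)
  rw [← Real.rpow_natCast, ← Real.rpow_natCast, ← Real.rpow_natCast,
    Real.mul_rpow (Real.rpow_nonneg (h0 _ _) _) (Real.rpow_nonneg (h0 _ _) _)]
  simp only [← Real.rpow_mul (h0 _ _), mul_comm]

/-- Truncated eigenvalues are at most `α j` and at most `s ^ 2`, hence at most `min (√(α j)) s ^ 2`.
-/
lemma norm_compound_sandwich_logSqrtMin_le {M : Matrix (Fin N) (Fin N) ℂ}
    (hM : M ∈ unitaryGroup (Fin N) ℂ) {a b : Fin N → ℝ} (ha : ∀ i, 0 ≤ a i) (hb : ∀ i, 0 ≤ b i)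
    {α : Fin N → ℝ}
    (h : HasSortedEigenvalues (((realDiagonal fun i => √(a i)) * M * realDiagonal fun i => √(b i)) *
      ((realDiagonal fun i => √(a i)) * M * realDiagonal fun i => √(b i))ᴴ) α)
    {s : ℝ} (hs : 0 < s) (d : ℝ) {k : ℕ} (hk : k ≤ N) :
    ‖compound k (sandwich M a b (logSqrtMin s d))‖ ≤
      (∏ i : Fin k, expOffZero (logSqrtMin s d) (√(α (Fin.castLE hk i)))) ^ 2 := by
  set T' := (realDiagonal fun i => √(min (a i) s)) * M * realDiagonal fun i => √(min (b i) s)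
  obtain ⟨β, hβ⟩ := (isHermitian_mul_conjTranspose_self T').exists_hasSortedEigenvalues
  have hm : ∀ x : ℝ, 0 ≤ x → 0 ≤ min x s := fun x hx => le_min hx hs.le
  have h1 : ∀ j, β j ≤ α j := hβ.mono_sqrt_mul_sqrt (fun i => hm _ (ha i))
    (fun i => min_le_left _ _) (fun i => hm _ (hb i)) (fun i => min_le_left _ _) h
  have h2 : ∀ j, β j ≤ s ^ 2 := hβ.sqrt_mul_sqrt_le hM (fun i => hm _ (ha i))
    (fun i => min_le_right _ _) (fun i => hm _ (hb i)) (fun i => min_le_right _ _)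
  have hα : ∀ j, 0 ≤ α j := h.nonneg (posSemidef_self_mul_conjTranspose _)
  have hS : sandwich M a b (logSqrtMin s d) = ((Real.exp d ^ 2 : ℝ) : ℂ) • T' := by
    have hD : ∀ x : Fin N → ℝ, (∀ i, 0 ≤ x i) →
        (realDiagonal fun i => expOffZero (logSqrtMin s d) (x i)) =
          (Real.exp d : ℂ) • realDiagonal fun i => √(min (x i) s) := fun x hx => by
      rw [← realDiagonal_smul]
      simp only [expOffZero_logSqrtMin hs d (hx _)]
    rw [sandwich, hD a ha, hD b hb]
    simp only [smul_mul_assoc, mul_smul_comm, smul_smul]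
    congr 1
    push_cast
    ring
  have hST : sandwich M a b (logSqrtMin s d) * (sandwich M a b (logSqrtMin s d))ᴴ =
      ((Real.exp d ^ 4 : ℝ) : ℂ) • (T' * T'ᴴ) := by
    rw [hS, conjTranspose_smul, smul_mul_assoc, mul_smul_comm, smul_smul]
    congr 1
    rw [Complex.star_def, Complex.conj_ofReal]
    push_cast
    ring
  have hγ := hβ.smul (r := Real.exp d ^ 4) (by positivity)
  rw [← hST] at hγ
  refine le_of_sq_le_sq ?_ (by positivity)
  rw [hγ.norm_compound_sq hk, ← pow_mul, ← Finset.prod_pow]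
  refine Finset.prod_le_prod (fun i _ => mul_nonneg (by positivity)
    (hβ.nonneg (posSemidef_self_mul_conjTranspose _) _)) fun i _ => ?_
  rw [expOffZero_logSqrtMin hs d (Real.sqrt_nonneg _), mul_pow]
  refine mul_le_mul_of_nonneg_left ?_ (by positivity)
  rw [pow_mul, Real.sq_sqrt (hm _ (Real.sqrt_nonneg _))]
  rcases min_choice (√(α (Fin.castLE hk i))) s with h | h <;> rw [h]
  · rw [Real.sq_sqrt (hα _)]
    exact h1 _
  · exact h2 _

end Interpolation

end Matrix

/-! ### Concave functions as mixtures of truncations -/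

/-- On a finite set, a concave function with slopes in `[q, 1]` is a combination of truncations
`min · s`, the linear function of slope `q` and a constant. -/
lemma exists_eq_sum_min {ψ : ℝ → ℝ} (hconc : ConcaveOn ℝ Set.univ ψ)
    (hlip : Antitone fun t => ψ t - t) (S : Finset ℝ) (hS : S.Nonempty) :
    -- The slope `q` to the right of the largest node must vary for the induction: removing that
    -- node replaces `q` by the slope of the last chord.
    ∀ q, q ≤ 1 → (∀ x ∈ S, ∀ y ∈ S, x < y → q * (y - x) ≤ ψ y - ψ x) →
      ∃ (w : ℝ → ℝ) (d : ℝ), (∀ s ∈ S, 0 ≤ w s) ∧ ∑ s ∈ S, w s = 1 - q ∧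
        ∀ t ∈ S, ∑ s ∈ S, w s * min t s + q * t + d = ψ t := by
  induction S using Finset.induction_on_max with
  | empty => exact absurd hS Finset.not_nonempty_empty
  | insert x S hx ih =>
    intro q hq hslope
    have hxS : x ∉ S := fun h => lt_irrefl _ (hx x h)
    rcases S.eq_empty_or_nonempty with rfl | hne
    · refine ⟨fun _ => 1 - q, ψ x - x, fun _ _ => by linarith, by simp, fun t ht => ?_⟩
      obtain rfl : t = x := by simpa using ht
      simp
      ring
    set m := S.max' hne with hm
    have hmS : m ∈ S := S.max'_mem hne
    have hmx : m < x := hx m hmS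
    have hd : 0 < x - m := sub_pos.mpr hmx
    set q' := (ψ x - ψ m) / (x - m) with hq'
    have hq'm : q' * (x - m) = ψ x - ψ m := div_mul_cancel₀ _ hd.ne'
    have hqq' : q ≤ q' := by
      rw [hq', le_div_iff₀ hd]
      exact hslope m (Finset.mem_insert_of_mem hmS) x (Finset.mem_insert_self _ _) hmx
    have hq'1 : q' ≤ 1 := by
      rw [hq', div_le_one hd]
      have := hlip hmx.le
      simp only at this
      linarith
    obtain ⟨w, d, hw0, hw1, hw⟩ := ih hne q' hq'1 fun s hs t ht hst => by
      have htm : t ≤ m := S.le_max' t ht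
      have hts : 0 < t - s := sub_pos.mpr hst
      rw [← le_div_iff₀ hts]
      rcases htm.eq_or_lt with rfl | htm
      · exact hconc.slope_anti_adjacent trivial trivial hst hmx
      · exact (hconc.slope_anti_adjacent trivial trivial htm hmx).trans
          (hconc.slope_anti_adjacent trivial trivial hst htm)
    have hupd : ∀ g : ℝ → ℝ, ∑ s ∈ S, Function.update w x (q' - q) s * g s = ∑ s ∈ S, w s * g s :=
      fun g => Finset.sum_congr rfl fun s hs => by
        rw [Function.update_of_ne (ne_of_mem_of_not_mem hs hxS)]
    -- The weight at `x` is the drop in slope there. Since `min t x = t` on all nodes, it turns `q *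
    -- t` back into `q' * t`.
    refine ⟨Function.update w x (q' - q), d, fun s hs => ?_, ?_, fun t ht => ?_⟩
    · rcases Finset.mem_insert.mp hs with rfl | hs
      · simpa using hqq'
      · rw [Function.update_of_ne (ne_of_mem_of_not_mem hs hxS)]
        exact hw0 s hs
    · have := hupd fun _ => 1
      simp only [mul_one] at this
      rw [Finset.sum_insert hxS, this, hw1, Function.update_self]
      ring
    · rw [Finset.sum_insert hxS, hupd, Function.update_self]
      rcases Finset.mem_insert.mp ht with rfl | ht
      · have h1 : ∑ s ∈ S, w s * min t s = ∑ s ∈ S, w s * min m s :=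
          Finset.sum_congr rfl fun s hs => by
            rw [min_eq_right (hx s hs).le, min_eq_right (S.le_max' s hs)]
        rw [h1, min_self]
        linarith [hw m hmS]
      · rw [min_eq_left (hx t ht).le, ← hw t ht]
        ring

/-! ### Concavity of t ↦ log (1 - exp (-eᵗ)) and its slopes -/

section OneSubExp

open Real

lemma hasDerivAt_log_one_sub_exp (t : ℝ) :
    HasDerivAt (fun t => log (1 - exp (-exp t))) (exp t / (exp (exp t) - 1)) t := by
  have h1 : exp (-exp t) < 1 := exp_lt_one_iff.mpr (neg_neg_iff_pos.mpr (exp_pos t))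
  have h0 : HasDerivAt (fun t => -exp t) (-exp t) t := (hasDerivAt_exp t).neg
  have h : HasDerivAt (fun t => log (1 - exp (-exp t)))
      (-(exp (-exp t) * -exp t) / (1 - exp (-exp t))) t :=
    ((h0.exp).const_sub 1).log (by linarith)
  convert! h using 1
  have h2 : exp (exp t) * exp (-exp t) = 1 := by rw [← exp_add]; simp
  have h3 : 1 < exp (exp t) := one_lt_exp_iff.mpr (exp_pos t)
  rw [div_eq_div_iff (by linarith) (by linarith)]
  linear_combination (-exp t) * h2

/-- Chords of the convex function `exp` starting at 0 have increasing slope, so u / (eᵘ - 1)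
decreases; with u = eᵗ this is the derivative above. -/
lemma mul_exp_sub_one_le {x y : ℝ} (hx : 0 ≤ x) (hxy : x ≤ y) :
    y * (exp x - 1) ≤ x * (exp y - 1) := by
  rcases (hx.trans hxy).eq_or_lt with rfl | hy
  · simp [le_antisymm hxy hx]
  have h := convexOn_exp.2 (Set.mem_univ 0) (Set.mem_univ y) 
    (sub_nonneg.mpr ((div_le_one hy).mpr hxy)) (div_nonneg hx hy.le) (sub_add_cancel 1 (x / y))
  simp only [smul_eq_mul, mul_zero, zero_add, exp_zero, mul_one] at h
  rw [div_mul_cancel₀ _ hy.ne'] at h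
  have h' := mul_le_mul_of_nonneg_left h hy.le
  have e : y * (x / y) = x := mul_div_cancel₀ _ hy.ne'
  have e' : y * (1 - x / y + x / y * exp y) = y - y * (x / y) + y * (x / y) * exp y := by ring
  rw [e', e] at h'
  linarith

lemma concaveOn_log_one_sub_exp : ConcaveOn ℝ Set.univ fun t => log (1 - exp (-exp t)) := by
  refine AntitoneOn.concaveOn_of_deriv convex_univ ?_ ?_ ?_
  · exact fun t _ => (hasDerivAt_log_one_sub_exp t).continuousAt.continuousWithinAt
  · exact fun t _ => (hasDerivAt_log_one_sub_exp t).differentiableAt.differentiableWithinAt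
  · intro s _ t _ hst
    rw [(hasDerivAt_log_one_sub_exp t).deriv, (hasDerivAt_log_one_sub_exp s).deriv]
    have h1 : ∀ u, 0 < exp (exp u) - 1 := fun u => sub_pos.mpr (one_lt_exp_iff.mpr (exp_pos u))
    rw [div_le_div_iff₀ (h1 _) (h1 _)]
    exact mul_exp_sub_one_le (exp_pos s).le (exp_le_exp.mpr hst)

lemma monotone_log_one_sub_exp : Monotone fun t => log (1 - exp (-exp t)) := by
  intro s t hst
  refine log_le_log (sub_pos.mpr (exp_lt_one_iff.mpr (neg_neg_iff_pos.mpr (exp_pos s)))) ?_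
  gcongr

lemma antitone_log_one_sub_exp_sub : Antitone fun t => log (1 - exp (-exp t)) - t := by
  refine antitone_of_hasDerivAt_nonpos
    (fun t => (hasDerivAt_log_one_sub_exp t).sub (hasDerivAt_id t)) fun t => ?_
  have h1 : 0 < exp (exp t) - 1 := sub_pos.mpr (one_lt_exp_iff.mpr (exp_pos t))
  exact sub_nonpos.mpr ((div_le_one h1).mpr (by linarith [add_one_le_exp (exp t)]))

end OneSubExp

/-- On a finite set, `√(1 - exp (-x))` is a geometric combination of truncated square roots. -/
lemma exists_sum_logSqrtMin (S : Finset ℝ) (hS : S.Nonempty) :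
    ∃ (w : ℝ → ℝ) (d : ℝ), (∀ s ∈ S, 0 ≤ w s) ∧ ∑ s ∈ S, w s = 1 ∧
      ∀ x : ℝ, 0 ≤ x → (x ≠ 0 → Real.log x ∈ S) →
        expOffZero (∑ s ∈ S, w s • logSqrtMin (Real.exp s) d) x = √(1 - Real.exp (-x)) := by
  -- Monotonicity permits `q = 0`: no linear term remains and the weights sum to 1.
  obtain ⟨w, d, hw0, hw1, hw⟩ := exists_eq_sum_min concaveOn_log_one_sub_exp
    antitone_log_one_sub_exp_sub S hS 0 zero_le_one
    fun x _ y _ hxy => by simpa using monotone_log_one_sub_exp hxy.le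
  refine ⟨w, d / 2, hw0, by simpa using hw1, fun x hx hxS => ?_⟩
  unfold expOffZero
  split_ifs with h
  · simp [h]
  have hx0 : 0 < x := hx.lt_of_ne' h
  have h1 := hw _ (hxS h)
  rw [Real.exp_log hx0] at h1
  have h2 : (∑ s ∈ S, w s • logSqrtMin (Real.exp s) (d / 2)) x =
      Real.log (1 - Real.exp (-x)) * (1 / 2) := by
    rw [← h1, Finset.sum_apply]
    have h3 : ∀ s ∈ S, (w s • logSqrtMin (Real.exp s) (d / 2)) x =
        w s * min (Real.log x) s * (1 / 2) + w s * (d / 2) := fun s _ => by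
      have : Real.log (min x (Real.exp s)) = min (Real.log x) s := by
        rcases le_total x (Real.exp s) with h | h
        · rw [min_eq_left h, min_eq_left ((Real.log_le_iff_le_exp hx0).mpr h)]
        · rw [min_eq_right h, min_eq_right ((Real.le_log_iff_exp_le hx0).mpr h), Real.log_exp]
      simp only [logSqrtMin, Pi.smul_apply, smul_eq_mul, this]
      ring
    rw [Finset.sum_congr rfl h3, Finset.sum_add_distrib, ← Finset.sum_mul, ← Finset.sum_mul, hw1]
    ring
  have h4 : 0 < 1 - Real.exp (-x) := sub_pos.mpr (Real.exp_lt_one_iff.mpr (by linarith))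
  rw [h2, Real.sqrt_eq_rpow, Real.rpow_def_of_pos h4]

/-! ### From products to sums -/

/-- Weak log-majorization of a decreasing nonnegative sequence implies weak majorization. -/
lemma sum_le_sum_of_prod_le_prod {x y : ℕ → ℝ} (hx : Antitone x) (hx0 : ∀ i, 0 ≤ x i)
    (hy0 : ∀ i, 0 ≤ y i) (N : ℕ)
    (h : ∀ k ≤ N, ∏ i ∈ Finset.range k, x i ≤ ∏ i ∈ Finset.range k, y i) :
    ∑ i ∈ Finset.range N, x i ≤ ∑ i ∈ Finset.range N, y i := by
  induction N with
  | zero => simp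
  | succ N ih =>
    rcases (hx0 N).eq_or_lt with h0 | hpos
    · rw [Finset.sum_range_succ, Finset.sum_range_succ, ← h0]
      exact add_le_add (ih fun k hk => h k (hk.trans N.le_succ)) (hy0 N)
    have hxp : ∀ i ≤ N, 0 < x i := fun i hi => hpos.trans_le (hx hi)
    have hprod : 0 < ∏ i ∈ Finset.range (N + 1), y i :=
      (Finset.prod_pos fun i hi => hxp i (Finset.mem_range_succ_iff.mp hi)).trans_le (h _ le_rfl)
    have hyp : ∀ i ≤ N, 0 < y i := fun i hi => (hy0 i).lt_of_ne fun e =>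
      hprod.ne' (Finset.prod_eq_zero (Finset.mem_range_succ_iff.mpr hi) e.symm)
    -- Partial sums of `l` are nonnegative, so Abel summation against the decreasing `x` gives Σ
    -- xᵢlᵢ ≥ 0; then x log(y/x) ≤ y - x.
    set l : ℕ → ℝ := fun i => Real.log (y i) - Real.log (x i)
    have hl : ∀ k ≤ N + 1, 0 ≤ ∑ i ∈ Finset.range k, l i := fun k hk => by
      have hlt : ∀ i ∈ Finset.range k, i ≤ N := fun i hi => by
        have := Finset.mem_range.mp hi
        omega
      rw [Finset.sum_sub_distrib, sub_nonneg,
        ← Real.log_prod fun i hi => (hxp i (hlt i hi)).ne',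
        ← Real.log_prod fun i hi => (hyp i (hlt i hi)).ne']
      exact Real.log_le_log (Finset.prod_pos fun i hi => hxp i (hlt i hi)) (h k hk)
    have habel : ∀ m ≤ N, x m * ∑ i ∈ Finset.range (m + 1), l i ≤
        ∑ i ∈ Finset.range (m + 1), x i * l i := by
      intro m
      induction m with
      | zero => simp
      | succ m ihm =>
        intro hm
        rw [Finset.sum_range_succ _ (m + 1), Finset.sum_range_succ _ (m + 1), mul_add]
        refine add_le_add (le_trans ?_ (ihm (by omega))) le_rfl
        exact mul_le_mul_of_nonneg_right (hx m.le_succ) (hl _ (by omega))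
    have h1 : 0 ≤ ∑ i ∈ Finset.range (N + 1), x i * l i :=
      (mul_nonneg (hx0 N) (hl _ le_rfl)).trans (habel N le_rfl)
    have h2 : ∑ i ∈ Finset.range (N + 1), x i * l i ≤ ∑ i ∈ Finset.range (N + 1), (y i - x i) := by
      refine Finset.sum_le_sum fun i hi => ?_
      have hi' := Finset.mem_range_succ_iff.mp hi
      have h3 := Real.log_le_sub_one_of_pos (div_pos (hyp i hi') (hxp i hi'))
      rw [Real.log_div (hyp i hi').ne' (hxp i hi').ne'] at h3
      have h4 := mul_le_mul_of_nonneg_left h3 (hx0 i)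
      rwa [mul_sub _ _ (1 : ℝ), mul_div_cancel₀ _ (hxp i hi').ne', mul_one] at h4
    rw [Finset.sum_sub_distrib] at h2
    linarith

namespace Matrix

/-! ### The inequality for diagonalized matrices -/

section Core

open scoped Matrix.Norms.L2Operator

variable {N : ℕ}

lemma sum_le_sum_of_prod_castLE_le {x y : Fin N → ℝ} (hx : Antitone x) (hx0 : ∀ i, 0 ≤ x i)
    (hy0 : ∀ i, 0 ≤ y i)
    (h : ∀ k (hk : k ≤ N), ∏ i : Fin k, x (Fin.castLE hk i) ≤ ∏ i : Fin k, y (Fin.castLE hk i)) :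
    ∑ i, x i ≤ ∑ i, y i := by
  let ext (z : Fin N → ℝ) (i : ℕ) : ℝ := if hi : i < N then z ⟨i, hi⟩ else 0
  have hext : ∀ z : Fin N → ℝ, (∀ i, 0 ≤ z i) → ∀ i, 0 ≤ ext z i := fun z hz i => by
    simp only [ext]
    split_ifs
    exacts [hz _, le_rfl]
  have hprod : ∀ z : Fin N → ℝ, ∀ k (hk : k ≤ N),
      ∏ i ∈ Finset.range k, ext z i = ∏ i : Fin k, z (Fin.castLE hk i) := fun z k hk => by
    rw [Finset.prod_range]
    refine Finset.prod_congr rfl fun i _ => ?_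
    simp only [ext, dif_pos (i.2.trans_le hk)]
    rfl
  have hsum : ∀ z : Fin N → ℝ, ∑ i ∈ Finset.range N, ext z i = ∑ i, z i := fun z => by
    rw [Finset.sum_range]
    exact Finset.sum_congr rfl fun i _ => by simp [ext]
  rw [← hsum, ← hsum]
  refine sum_le_sum_of_prod_le_prod (fun i j hij => ?_) (hext x hx0) (hext y hy0) N fun k hk => ?_
  · by_cases hj : j < N
    · simp only [ext, dif_pos hj, dif_pos (hij.trans_lt hj)]
      exact hx hij
    · simp only [ext, dif_neg hj]
      exact hext x hx0 i
  · rw [hprod x k hk, hprod y k hk]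
    exact h k hk

/-- The trace inequality for `x ↦ 1 - exp (-x)`, in diagonalized form. -/
theorem trace_one_sub_exp_mul_le {M : Matrix (Fin N) (Fin N) ℂ}
    (hM : M ∈ unitaryGroup (Fin N) ℂ) {a b : Fin N → ℝ} (ha : ∀ i, 0 ≤ a i) (hb : ∀ i, 0 ≤ b i)
    {α : Fin N → ℝ}
    (h : HasSortedEigenvalues (((realDiagonal fun i => √(a i)) * M * realDiagonal fun i => √(b i)) *
      ((realDiagonal fun i => √(a i)) * M * realDiagonal fun i => √(b i))ᴴ) α) :
    ((realDiagonal fun i => 1 - Real.exp (-a i)) * M * (realDiagonal fun i => 1 - Real.exp (-b i)) *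
      Mᴴ).trace ≤ ((∑ i, (1 - Real.exp (-√(α i))) ^ 2 : ℝ) : ℂ) := by
  classical
  -- The logarithms of all points where `f` is evaluated; 0 only ensures nonemptiness.
  set S : Finset ℝ := insert 0 (Finset.univ.image (fun i => Real.log (a i)) ∪
    Finset.univ.image (fun i => Real.log (b i)) ∪
    Finset.univ.image fun i => Real.log (√(α i)))
  obtain ⟨w, d, hw0, hw1, hw⟩ := exists_sum_logSqrtMin S (Finset.insert_nonempty _ _)
  set φ := ∑ s ∈ S, w s • logSqrtMin (Real.exp s) d
  have hφa : ∀ i, expOffZero φ (a i) = √(1 - Real.exp (-a i)) :=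
    fun i => hw _ (ha i) fun _ => by simp [S]
  have hφb : ∀ i, expOffZero φ (b i) = √(1 - Real.exp (-b i)) :=
    fun i => hw _ (hb i) fun _ => by simp [S]
  have hφα : ∀ i, expOffZero φ (√(α i)) = √(1 - Real.exp (-√(α i))) :=
    fun i => hw _ (Real.sqrt_nonneg _) fun _ => by simp [S]
  have hf : ∀ x : ℝ, 0 ≤ x → 0 ≤ 1 - Real.exp (-x) := fun x hx =>
    sub_nonneg.mpr (Real.exp_le_one_iff.mpr (by linarith))
  set T := sandwich M a b φ with hT
  obtain ⟨β, hβ⟩ := (isHermitian_mul_conjTranspose_self T).exists_hasSortedEigenvalues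
  have htrace : ((realDiagonal fun i => 1 - Real.exp (-a i)) * M *
      (realDiagonal fun i => 1 - Real.exp (-b i)) * Mᴴ).trace = (T * Tᴴ).trace := by
    have h1 : T * Tᴴ = (realDiagonal fun i => √(1 - Real.exp (-a i))) *
        (M * (realDiagonal fun i => 1 - Real.exp (-b i)) * Mᴴ) *
        (realDiagonal fun i => √(1 - Real.exp (-a i))) := by
      rw [hT, sandwich]
      simp only [hφa, hφb]
      rw [mul_realDiagonal_sqrt_mul_conjTranspose _ fun i => hf _ (hb i), conjTranspose_mul,
        realDiagonal_conjTranspose]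
      simp only [mul_assoc]
    rw [h1, trace_mul_comm (_ * _) (realDiagonal _), ← mul_assoc, realDiagonal_mul]
    simp only [Real.mul_self_sqrt (hf _ (ha _)), mul_assoc]
  rw [htrace, hβ.trace_eq, ← Complex.ofReal_sum, Complex.real_le_real]
  refine sum_le_sum_of_prod_castLE_le hβ.1 (hβ.nonneg (posSemidef_self_mul_conjTranspose _))
    (fun _ => sq_nonneg _) fun k hk => ?_
  have hmem : φ ∈ {φ | ‖compound k (sandwich M a b φ)‖ ≤
      (∏ i : Fin k, expOffZero φ (√(α (Fin.castLE hk i)))) ^ 2} :=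
    (convex_setOf_norm_compound_sandwich_le M a b _).sum_mem hw0 hw1 fun s _ =>
      norm_compound_sandwich_logSqrtMin_le hM ha hb h (Real.exp_pos s) d hk
  rw [Set.mem_ofPred_eq] at hmem
  rw [← hβ.norm_compound_sq hk]
  refine (pow_le_pow_left₀ (norm_nonneg _) hmem 2).trans (le_of_eq ?_)
  rw [← pow_mul, ← Finset.prod_pow]
  refine Finset.prod_congr rfl fun i _ => ?_
  rw [hφα, pow_mul, Real.sq_sqrt (hf _ (Real.sqrt_nonneg _))]

end Core

/-! ### Reduction of the general case to diagonal form -/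

section General

lemma trace_submatrix_equiv {m n : Type*} [Fintype m] [Fintype n] (X : Matrix n n ℂ) (e : m ≃ n) :
    (X.submatrix e e).trace = X.trace :=
  e.sum_comp fun i => X i i

variable {n : Type*} [Fintype n] [DecidableEq n]

lemma IsHermitian.exists_unitary {A : Matrix n n ℂ} (hA : A.IsHermitian) :
    ∃ U ∈ unitaryGroup n ℂ, A = U * realDiagonal hA.eigenvalues * star U := by
  refine ⟨hA.eigenvectorUnitary.1, hA.eigenvectorUnitary.2, ?_⟩
  have := hA.spectral_theorem
  rw [Unitary.conjStarAlgAut_apply] at this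
  exact this

lemma exp_unitary_conj_realDiagonal {U : Matrix n n ℂ} (hU : U ∈ unitaryGroup n ℂ) (x : n → ℝ) :
    NormedSpace.exp (U * realDiagonal x * star U) =
      U * (realDiagonal fun i => Real.exp (x i)) * star U := by
  have hinv : U⁻¹ = star U := inv_eq_right_inv (mem_unitaryGroup_iff.mp hU)
  have hunit : IsUnit U :=
    ⟨⟨U, star U, mem_unitaryGroup_iff.mp hU, mem_unitaryGroup_iff'.mp hU⟩, rfl⟩
  rw [← hinv, exp_conj _ _ hunit, exp_diagonal]
  congr 3
  ext i
  rw [Pi.coe_exp, ← Complex.exp_eq_exp_ℂ, Complex.ofReal_exp]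

lemma unitary_conj_mul {U : Matrix n n ℂ} (hU : U ∈ unitaryGroup n ℂ) (X Y : Matrix n n ℂ) :
    (U * X * star U) * (U * Y * star U) = U * (X * Y) * star U := by
  calc _ = U * X * (star U * U) * Y * star U := by simp only [mul_assoc]
    _ = _ := by rw [mem_unitaryGroup_iff'.mp hU]; simp only [mul_assoc, mul_one]

lemma trace_unitary_conj {U : Matrix n n ℂ} (hU : U ∈ unitaryGroup n ℂ) (X : Matrix n n ℂ) :
    (U * X * star U).trace = X.trace := by
  rw [trace_mul_comm, ← mul_assoc, mem_unitaryGroup_iff'.mp hU, one_mul]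

lemma charpoly_unitary_conj {U : Matrix n n ℂ} (hU : U ∈ unitaryGroup n ℂ) (X : Matrix n n ℂ) :
    (U * X * star U).charpoly = X.charpoly := by
  rw [charpoly_mul_comm, ← mul_assoc, mem_unitaryGroup_iff'.mp hU, one_mul]

lemma exp_neg_smul_unitary_conj_realDiagonal {U : Matrix n n ℂ} (hU : U ∈ unitaryGroup n ℂ)
    (x : n → ℝ) (r : ℝ) :
    NormedSpace.exp (-((r : ℂ) • (U * realDiagonal x * star U))) =
      U * (realDiagonal fun i => Real.exp (-(r * x i))) * star U := by
  rw [← exp_unitary_conj_realDiagonal hU]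
  congr 1
  have : (realDiagonal fun i => -(r * x i)) = -((r : ℂ) • realDiagonal x) := by
    rw [← neg_smul, ← Complex.ofReal_neg, ← realDiagonal_smul]
    simp only [neg_mul]
  rw [this, mul_neg, neg_mul, mul_smul_comm, smul_mul_assoc]

lemma one_sub_exp_neg_unitary_conj_realDiagonal {U : Matrix n n ℂ} (hU : U ∈ unitaryGroup n ℂ)
    (x : n → ℝ) :
    1 - NormedSpace.exp (-(U * realDiagonal x * star U)) =
      U * (realDiagonal fun i => 1 - Real.exp (-x i)) * star U := by
  have h := exp_neg_smul_unitary_conj_realDiagonal hU x 1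
  simp only [Complex.ofReal_one, one_smul, one_mul] at h
  have h1 : (realDiagonal fun i => 1 - Real.exp (-x i)) =
      1 - realDiagonal fun i => Real.exp (-x i) := by
    rw [← diagonal_one, realDiagonal, realDiagonal, diagonal_sub]
    simp
  rw [h, h1, mul_sub, sub_mul, mul_one, mem_unitaryGroup_iff.mp hU]

lemma sqrt_unitary_conj_realDiagonal {U : Matrix n n ℂ} (hU : U ∈ unitaryGroup n ℂ) {x : n → ℝ}
    (hx : ∀ i, 0 ≤ x i) :
    CFC.sqrt (U * realDiagonal x * star U) = U * (realDiagonal fun i => √(x i)) * star U := by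
  refine CFC.sqrt_unique ?_ ?_
  · rw [unitary_conj_mul hU, realDiagonal_mul]
    simp only [Real.mul_self_sqrt (hx _)]
  · rw [nonneg_iff_posSemidef, star_eq_conjTranspose]
    refine PosSemidef.mul_mul_conjTranspose_same (PosSemidef.diagonal fun i => ?_) U
    simp

/-- A complement to the Golden–Thompson inequality. -/
theorem trace_exp_neg_mul_exp_neg_le (A B : Matrix n n ℂ) (hA : A.PosSemidef) (hB : B.PosSemidef)
    (C : Matrix n n ℂ) (hC : C = CFC.sqrt (CFC.sqrt A * B * CFC.sqrt A)) :
    (NormedSpace.exp (-A) * NormedSpace.exp (-B)).trace ≤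
      (NormedSpace.exp (-A) + NormedSpace.exp (-B)).trace +
        (NormedSpace.exp (-((2 : ℂ) • C)) - (2 : ℂ) • NormedSpace.exp (-C)).trace := by
  obtain ⟨U, hU, hAU⟩ := hA.isHermitian.exists_unitary
  obtain ⟨V, hV, hBV⟩ := hB.isHermitian.exists_unitary
  set a := hA.isHermitian.eigenvalues
  set b := hB.isHermitian.eigenvalues
  have ha : ∀ i, 0 ≤ a i := hA.eigenvalues_nonneg
  have hb : ∀ i, 0 ≤ b i := hB.eigenvalues_nonneg
  have hsA : 0 ≤ CFC.sqrt A := CFC.sqrt_nonneg A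
  have hK : 0 ≤ CFC.sqrt A * B * CFC.sqrt A := by
    have h1 := hB.mul_mul_conjTranspose_same (CFC.sqrt A)
    rw [(nonneg_iff_posSemidef.mp hsA).isHermitian.eq] at h1
    exact nonneg_iff_posSemidef.mpr h1
  have hCps : C.PosSemidef := by
    rw [hC]
    exact nonneg_iff_posSemidef.mp (CFC.sqrt_nonneg _)
  obtain ⟨W, hW, hCW⟩ := hCps.isHermitian.exists_unitary
  set c := hCps.isHermitian.eigenvalues
  have hc : ∀ i, 0 ≤ c i := hCps.eigenvalues_nonneg
  have hCC : C * C = CFC.sqrt A * B * CFC.sqrt A := by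
    rw [hC]
    exact CFC.sqrt_mul_sqrt_self _ hK
  set M := star U * V with hMdef
  have hM : M ∈ unitaryGroup n ℂ := mul_mem (Unitary.star_mem hU) hV
  have hMc : Mᴴ = star V * U := by
    rw [← star_eq_conjTranspose, hMdef, star_mul, star_star]
  let e := Fintype.equivFin n
  let Me := M.submatrix e.symm e.symm
  have hMe : Me ∈ unitaryGroup (Fin (Fintype.card n)) ℂ := by
    rw [mem_unitaryGroup_iff, star_eq_conjTranspose, conjTranspose_submatrix, submatrix_mul_equiv,
      ← star_eq_conjTranspose, mem_unitaryGroup_iff.mp hM, submatrix_one_equiv]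
  have hDe : ∀ x : n → ℝ, (realDiagonal fun i => x (e.symm i)) =
      (realDiagonal x).submatrix e.symm e.symm := fun x => by
    rw [realDiagonal, realDiagonal, submatrix_diagonal_equiv]
    rfl
  set T := (realDiagonal fun i => √(a i)) * M * realDiagonal fun i => √(b i) with hT
  have hTe :
      ((realDiagonal fun i => √(a (e.symm i))) * Me * realDiagonal fun i => √(b (e.symm i))) =
      T.submatrix e.symm e.symm := by
    rw [hDe fun i => √(a i), hDe fun i => √(b i), submatrix_mul_equiv, submatrix_mul_equiv]
  obtain ⟨α, hα⟩ := (isHermitian_mul_conjTranspose_self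
    (T.submatrix e.symm e.symm)).exists_hasSortedEigenvalues
  have hTT : T * Tᴴ = star U * (C * C) * U := by
    rw [hCC, hT, mul_realDiagonal_sqrt_mul_conjTranspose _ hb, conjTranspose_mul,
      realDiagonal_conjTranspose, hMc]
    rw [hAU, hBV, sqrt_unitary_conj_realDiagonal hU ha, hMdef]
    have hUU := mem_unitaryGroup_iff'.mp hU
    simp only [mul_assoc, hUU, mul_one]
    simp only [← mul_assoc, hUU, one_mul]
  -- `T * Tᴴ` is unitarily similar to C², so the values `α` are the squares of the `c i` up to
  -- order.
  have hsum : ∀ g : ℝ → ℝ, ∑ i, g (α i) = ∑ i, g (c i * c i) := by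
    intro g
    have h1 : (T.submatrix e.symm e.symm * (T.submatrix e.symm e.symm)ᴴ).charpoly =
        ∏ i, (Polynomial.X - Polynomial.C ((c i * c i : ℝ) : ℂ)) := by
      rw [conjTranspose_submatrix, submatrix_mul_equiv, hTT]
      have h2 : star U * (C * C) * U = star U * (C * C) * star (star U) := by rw [star_star]
      rw [← reindex_apply, charpoly_reindex, h2, charpoly_unitary_conj (Unitary.star_mem hU), hCW,
        unitary_conj_mul hW, charpoly_unitary_conj hW, realDiagonal_mul, charpoly_diagonal]
    rw [hα.charpoly_eq] at h1
    have h2 := congrArg Polynomial.roots h1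
    rw [Polynomial.roots_prod _ _ (Polynomial.monic_prod_X_sub_C _ _).ne_zero,
      Polynomial.roots_prod _ _ (Polynomial.monic_prod_X_sub_C _ _).ne_zero] at h2
    simp only [Polynomial.roots_X_sub_C, Multiset.bind_singleton] at h2
    have h3 := congrArg (fun s => (Multiset.map (fun z : ℂ => g z.re) s).sum) h2
    simp only [Multiset.map_map, Function.comp_def, Complex.ofReal_re] at h3
    exact h3
  have key := trace_one_sub_exp_mul_le hMe (fun i => ha (e.symm i)) (fun i => hb (e.symm i))
    (hTe ▸ hα)
  have hl : ((realDiagonal fun i => 1 - Real.exp (-a (e.symm i))) * Me *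
      (realDiagonal fun i => 1 - Real.exp (-b (e.symm i))) * Meᴴ).trace =
      ((1 - NormedSpace.exp (-A)) * (1 - NormedSpace.exp (-B))).trace := by
    rw [hDe fun i => 1 - Real.exp (-a i), hDe fun i => 1 - Real.exp (-b i),
      conjTranspose_submatrix, submatrix_mul_equiv, submatrix_mul_equiv, submatrix_mul_equiv,
      trace_submatrix_equiv, hMc, hAU, hBV,
      one_sub_exp_neg_unitary_conj_realDiagonal hU, one_sub_exp_neg_unitary_conj_realDiagonal hV]
    rw [← mul_assoc, trace_mul_comm, hMdef]
    simp only [mul_assoc]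
  have hr : (((∑ i, (1 - Real.exp (-√(α i))) ^ 2 : ℝ)) : ℂ) =
      (1 + NormedSpace.exp (-((2 : ℂ) • C)) - (2 : ℂ) • NormedSpace.exp (-C)).trace := by
    have h1 : NormedSpace.exp (-C) =
        W * (realDiagonal fun i => Real.exp (-(1 * c i))) * star W := by
      have := exp_neg_smul_unitary_conj_realDiagonal hW c 1
      rwa [Complex.ofReal_one, one_smul, ← hCW] at this
    have h2 : NormedSpace.exp (-((2 : ℂ) • C)) =
        W * (realDiagonal fun i => Real.exp (-(2 * c i))) * star W := by
      have := exp_neg_smul_unitary_conj_realDiagonal hW c 2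
      rwa [Complex.ofReal_ofNat, ← hCW] at this
    rw [trace_sub, trace_add, trace_smul, h1, h2, trace_unitary_conj hW, trace_unitary_conj hW,
      ← diagonal_one, trace_diagonal, trace_diagonal, trace_diagonal, smul_eq_mul, Finset.mul_sum,
      ← Finset.sum_add_distrib, ← Finset.sum_sub_distrib,
      hsum fun x => (1 - Real.exp (-√x)) ^ 2, Complex.ofReal_sum]
    refine Finset.sum_congr rfl fun i _ => ?_
    have h3 : Real.exp (-(2 * c i)) = Real.exp (-c i) ^ 2 := by
      rw [← Real.exp_nat_mul]
      congr 1
      push_cast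
      ring
    beta_reduce
    rw [Real.sqrt_mul_self (hc i), h3, one_mul]
    push_cast
    ring
  rw [hl, hr] at key
  -- After expansion the trace of the identity cancels on both sides.
  simp only [mul_sub, sub_mul, mul_one, one_mul, trace_sub, trace_add] at key ⊢
  rw [← sub_nonneg] at key ⊢
  refine le_of_le_of_eq key ?_
  ring

end General

end Matrix

theorem mainTheorem3 {n : Type*} [Fintype n] [DecidableEq n]
    (A B : Matrix n n ℂ) (hA : A.PosSemidef) (hB : B.PosSemidef)
    (C : Matrix n n ℂ) (hC : C = CFC.sqrt (CFC.sqrt A * B * CFC.sqrt A)) :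
    (NormedSpace.exp (-A) * NormedSpace.exp (-B)).trace ≤
      (NormedSpace.exp (-A) + NormedSpace.exp (-B)).trace +
        (NormedSpace.exp (-((2 : ℂ) • C)) - (2 : ℂ) • NormedSpace.exp (-C)).trace :=
  Matrix.trace_exp_neg_mul_exp_neg_le A B hA hB C hC
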